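/- Let $(\Omega,\mathcal F,\mathbb P)$ be a probability space with a filtration $(\mathcal F_t)_{t\ge 0}$ satisfying the usual conditions (right continuity, and $\mathcal F_0$ contains all negligible events). Let $W$ be a scalar $(\mathcal F_t)$-Brownian motion and let $P^1,\dots,P^{\tilde q}$ be mutually independent $(\mathcal F_t)$-Poisson processes with rates $\lambda_1,\dots,\lambda_{\tilde q}$, independent of $W$. A jump linear stochastic system (JLSS) $\Sigma=(A,B,C,D,E,\mathsf R)$, $\mathsf R=\{R_1,\dots,R_{\tilde q}\}$, consists of real matrices $A,E,R_i\in\mathbb R^{n\times n}$, $B\in\mathbb R^{n\times m}$, $C\in\mathbb R^{q\times n}$, $D\in\mathbb R^{n\times p}$. A trajectory of $\Sigma$ is a tuple $(\xi,\zeta,\nu,\omega)$ of processes with values in $\mathbb R^n,\mathbb R^q,\mathbb R^m,\mathbb R^p$, where $\nu,\omega$ are progressively measurable, $\xi$ is progressively measurable with almost surely càdlàg paths, the drift $A\xi+B\nu+D\omega$ is almost surely integrable in time over bounded intervals, and, $\mathbb P$-almost surely, for all $t\ge0$, $$\xi(t)=\xi(0)+\int_0^t\big(A\xi(s)+B\nu(s)+D\omega(s)\big)\,ds+\int_0^tE\xi(s)\,dW_s+\sum_{i=1}^{\tilde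 q}\int_{(0,t]}R_i\xi(s-)\,dP^i_s,\qquad \zeta(t)=C\xi(t).$$ **Theorem.** Let $\Sigma=(A,B,C,D,E,\mathsf R)$ and $\hat\Sigma=(\hat A,\hat B,\hat C,\hat D,\hat E,\hat{\mathsf R})$ be two JLSS driven by the same $W,P^1,\dots,P^{\tilde q}$, with state dimensions $n,\hat n$, with the same internal input dimension $p=\hat p$ and the same output dimension $q=\hat q$. Suppose that there are matrices $P\in\mathbb R^{n\times\hat n}$, $Q\in\mathbb R^{m\times\hat n}$, $S\in\mathbb R^{m\times p}$ with $$AP=P\hat A-BQ,\quad D=P\hat D-BS,\quad CP=\hat C,\quad EP=P\hat E,\quad R_iP=P\hat R_i\ \ (1\le i\le\tilde q),$$ and that $\hat B=[\hat PB\;\;\hat PAG]$, where $\hat P\in\mathbb R^{\hat n\times n}$ and $G\in\mathbb R^{n\times l}$ satisfy, for some $F\in\mathbb R^{l\times n}$, $$C=\hat C\hat P,\quad I_n=P\hat P+GF,\quad I_{\hat n}=\hat PP,\quad 0=\hat PEGF,\quad 0=\hat PR_iGF\ \ (1\le i\le\tilde q).$$ Then for every trajectory $(\xi,\zeta,\nu,\omega)$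 of $\Sigma$ there exists a trajectory $(\hat\xi,\hat\zeta,\hat\nu,\hat\omega)$ of $\hat\Sigma$, with $\hat\xi=\hat P\xi$ and $\hat\omega=\omega$, such that $\mathbb P$-almost surely $\zeta(t)=\hat\zeta(t)$ for all $t\ge0$. -/

import Mathlib

open MeasureTheory ProbabilityTheory Filter Topology
open scoped NNReal ENNReal Matrix

noncomputable section

/-! Processes are maps `ℝ≥0 → Ω → E`, time first. State, input and output spaces are the
finite-dimensional coordinate spaces `ι → ℝ`; only their topology, which does not depend on the
choice of a norm, enters the definitions below. Time
integrals are taken over real intervals `(0, t]`, on which `Real.toNNReal` is the identity. -/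

section Noise

variable {Ω : Type*} {mΩ : MeasurableSpace Ω}

/-- The usual conditions: the filtration is right continuous and its initial σ-algebra contains
all negligible events. -/
structure UsualConditions (𝓕 : Filtration ℝ≥0 mΩ) (μ : Measure Ω) : Prop where
  rightContinuous : 𝓕.IsRightContinuous
  complete : ∀ s : Set Ω, MeasurableSet[mΩ] s → μ s = 0 → MeasurableSet[𝓕 0] s

/-- `W` is a scalar Brownian motion relative to the filtration `𝓕`: a (standard) Brownian motion
that is adapted and whose increments after time `s` are independent of `𝓕 s`. -/
structure IsFilteredBrownian (𝓕 : Filtration ℝ≥0 mΩ) (μ : Measure Ω)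
    (W : ℝ≥0 → Ω → ℝ) : Prop where
  brownian : IsBrownianReal W μ
  adapted : Adapted 𝓕 W
  indep : ∀ s t : ℝ≥0, s ≤ t →
    Indep (MeasurableSpace.comap (fun ω => W t ω - W s ω) inferInstance) (𝓕 s) μ

/-- `N` is a Poisson process with rate `rate` relative to the filtration `𝓕`: an adapted
counting process, started at zero, with nondecreasing right continuous paths, whose increments
over `(s, t]` have the Poisson law with parameter `rate * (t - s)` and are independent of `𝓕 s`.
(The subtraction `N t ω - N s ω` is exact almost surely, since the paths are monotone.) -/
structure IsFilteredPoisson (𝓕 : Filtration ℝ≥0 mΩ) (μ : Measure Ω) (rate : ℝ≥0)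
    (N : ℝ≥0 → Ω → ℕ) : Prop where
  adapted : Adapted 𝓕 N
  zero : ∀ᵐ ω ∂μ, N 0 ω = 0
  monotone : ∀ᵐ ω ∂μ, Monotone fun t => N t ω
  rightContinuous : ∀ᵐ ω ∂μ, ∀ t : ℝ≥0, ContinuousWithinAt (fun s => N s ω) (Set.Ici t) t
  law : ∀ s t : ℝ≥0, s ≤ t →
    HasLaw (fun ω => N t ω - N s ω) (poissonMeasure (rate * (t - s))) μ
  indep : ∀ s t : ℝ≥0, s ≤ t →
    Indep (MeasurableSpace.comap (fun ω => N t ω - N s ω) inferInstance) (𝓕 s) μ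

/-- The driving noise: a scalar Brownian motion `W` and Poisson processes `N i` with rates
`rate i`, all relative to one filtration that satisfies the usual conditions; the Poisson
processes are independent of each other, and of the Brownian motion. -/
structure IsDrivingNoise {r : Type*} (𝓕 : Filtration ℝ≥0 mΩ) (μ : Measure Ω)
    (W : ℝ≥0 → Ω → ℝ) (rate : r → ℝ≥0) (N : r → ℝ≥0 → Ω → ℕ) : Prop where
  usual : UsualConditions 𝓕 μ
  brownian : IsFilteredBrownian 𝓕 μ W
  poisson : ∀ i, IsFilteredPoisson 𝓕 μ (rate i) (N i)
  indep_poisson : iIndepFun (fun i ω t => N i t ω) μ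
  indep_brownian_poisson : IndepFun (fun ω t => W t ω) (fun ω i t => N i t ω) μ

end Noise

section StochasticIntegrals

variable {Ω : Type*} {mΩ : MeasurableSpace Ω}
  {E : Type*} [NormedAddCommGroup E] [NormedSpace ℝ E] [MeasurableSpace E]

/-- A simple process `∑_{j < card} value j · 1_{(time j, time (j+1)]}`, with nondecreasing
deterministic times and bounded values, the `j`-th one measurable with respect to
`𝓕 (time j)`. -/
structure SimpleProcess (𝓕 : Filtration ℝ≥0 mΩ) (E : Type*) [NormedAddCommGroup E]
    [MeasurableSpace E] where
  card : ℕ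
  time : ℕ → ℝ≥0
  value : ℕ → Ω → E
  monotone_time : Monotone time
  measurable_value : ∀ j, Measurable[𝓕 (time j)] (value j)
  bounded_value : ∃ c : ℝ, ∀ j ω, ‖value j ω‖ ≤ c

/-- The value of a simple process at time `t`. -/
def SimpleProcess.eval {𝓕 : Filtration ℝ≥0 mΩ} (V : SimpleProcess 𝓕 E) (t : ℝ≥0) (ω : Ω) : E :=
  ∑ j ∈ Finset.range V.card,
    Set.indicator (Set.Ioc (V.time j) (V.time (j + 1))) (fun _ => V.value j ω) t

/-- The elementary stochastic integral `∫₀ᵗ V dW` of a simple process. -/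
def SimpleProcess.integral {𝓕 : Filtration ℝ≥0 mΩ} (V : SimpleProcess 𝓕 E) (W : ℝ≥0 → Ω → ℝ)
    (t : ℝ≥0) (ω : Ω) : E :=
  ∑ j ∈ Finset.range V.card,
    (W (min t (V.time (j + 1))) ω - W (min t (V.time j)) ω) • V.value j ω

/-- `I` is (a version of) the Itô integral process `t ↦ ∫₀ᵗ X dW`: `I` is adapted with almost
surely continuous paths, and there are simple processes `V k` such that, for every horizon `T`,
as `k → ∞` one has, in probability, `∫₀ᵀ ‖V k - X‖² ds → 0` and
`sup_{t ≤ T} ‖∫₀ᵗ V k dW - I t‖ → 0`. -/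
def IsItoIntegral (𝓕 : Filtration ℝ≥0 mΩ) (μ : Measure Ω) (W : ℝ≥0 → Ω → ℝ)
    (X I : ℝ≥0 → Ω → E) : Prop :=
  Adapted 𝓕 I ∧ (∀ᵐ ω ∂μ, Continuous fun t => I t ω) ∧
  ∃ V : ℕ → SimpleProcess 𝓕 E, ∀ T : ℝ≥0, ∀ ε : ℝ≥0∞, 0 < ε →
    Tendsto (fun k => μ {ω | ε ≤ ∫⁻ s in Set.Ioc (0 : ℝ) T,
        ‖(V k).eval s.toNNReal ω - X s.toNNReal ω‖ₑ ^ 2})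
      atTop (𝓝 0) ∧
    Tendsto (fun k => μ {ω | ε ≤ ⨆ t ∈ Set.Icc 0 T, ‖(V k).integral W t ω - I t ω‖ₑ})
      atTop (𝓝 0)

/-- The pathwise integral `∫_{(0,t]} x(s-) dc(s)` of the left limits of a path `x` against a
counting path `c`: the sum over the jump times `s ∈ (0, t]` of `c` of `(c(s) - c(s-)) x(s-)`. -/
def jumpIntegral (x : ℝ≥0 → E) (c : ℝ≥0 → ℕ) (t : ℝ≥0) : E :=
  ∑ᶠ s ∈ Set.Ioc 0 t,
    ((c s : ℝ) - Function.leftLim (fun u => (c u : ℝ)) s) • Function.leftLim x s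

/-- A path is càdlàg: right continuous with left limits. -/
def IsCadlagPath (x : ℝ≥0 → E) : Prop :=
  ∀ t, ContinuousWithinAt x (Set.Ici t) t ∧ ∃ y, Tendsto x (𝓝[<] t) (𝓝 y)

end StochasticIntegrals

/-- The data `(A, B, C, D, E, R)` of a jump linear stochastic system with state coordinates `n`,
external input coordinates `m`, internal input coordinates `p`, output coordinates `q` and
jump events `r`. -/
structure JLSS (n m p q r : Type*) where
  A : Matrix n n ℝ
  B : Matrix n m ℝ
  C : Matrix q n ℝ
  D : Matrix n p ℝ
  E : Matrix n n ℝ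
  R : r → Matrix n n ℝ

section Trajectory

variable {Ω : Type*} {mΩ : MeasurableSpace Ω}
  {n m p q r : Type*} [Fintype n] [Fintype m] [Fintype p] [Fintype q] [Fintype r]

/-- The drift `A x + B u + D w`. -/
def JLSS.drift (S : JLSS n m p q r) (x : n → ℝ) (u : m → ℝ) (w : p → ℝ) : n → ℝ :=
  S.A *ᵥ x + S.B *ᵥ u + S.D *ᵥ w

/-- `(ξ, ζ, ν, w)` is a trajectory of the system `S` driven by `W` and `N`: the inputs `ν`, `w`
are progressively measurable, the solution process `ξ` is progressively measurable with almost
surely càdlàg paths, the drift is locally integrable in time, and almost surely, for all `t`,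
`ξ t = ξ 0 + ∫₀ᵗ (A ξ + B ν + D w) ds + ∫₀ᵗ E ξ dW + ∑ i, ∫_{(0,t]} R i ξ(s-) dN i` and
`ζ t = C ξ t`. -/
structure JLSS.IsTrajectory (S : JLSS n m p q r) (𝓕 : Filtration ℝ≥0 mΩ) (μ : Measure Ω)
    (W : ℝ≥0 → Ω → ℝ) (N : r → ℝ≥0 → Ω → ℕ) (ξ : ℝ≥0 → Ω → (n → ℝ)) (ζ : ℝ≥0 → Ω → (q → ℝ))
    (ν : ℝ≥0 → Ω → (m → ℝ)) (w : ℝ≥0 → Ω → (p → ℝ)) : Prop where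
  input : IsProgressive 𝓕 ν
  internal_input : IsProgressive 𝓕 w
  state : IsProgressive 𝓕 ξ
  cadlag : ∀ᵐ ω ∂μ, IsCadlagPath fun t => ξ t ω
  drift_integrable : ∀ᵐ ω ∂μ, ∀ t : ℝ≥0,
    IntegrableOn (fun s : ℝ => S.drift (ξ s.toNNReal ω) (ν s.toNNReal ω) (w s.toNNReal ω))
      (Set.Ioc 0 t)
  equation : ∃ I : ℝ≥0 → Ω → (n → ℝ),
    IsItoIntegral 𝓕 μ W (fun t ω => S.E *ᵥ ξ t ω) I ∧
    ∀ᵐ ω ∂μ, ∀ t : ℝ≥0, ξ t ω = ξ 0 ω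
      + (∫ s in Set.Ioc (0 : ℝ) t,
          S.drift (ξ s.toNNReal ω) (ν s.toNNReal ω) (w s.toNNReal ω))
      + I t ω
      + ∑ i, jumpIntegral (fun s => S.R i *ᵥ ξ s ω) (fun s => N i s ω) t
  output_measurable : ∀ t, Measurable (ζ t)
  output : ∀ᵐ ω ∂μ, ∀ t, ζ t ω = S.C *ᵥ ξ t ω

end Trajectory

end

/-!
The simulating trajectory is the image of the given one under `Ph`. Since `Ph * P = 1` and
`P * Ph = 1 - G * F`, the relations between the two systems give the matrix identities
`Sigh.E * Ph = Ph * Sig.E` and `Sigh.R i * Ph = Ph * Sig.R i`, so the diffusion and jump terms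
intertwine with `Ph`. The drift only intertwines up to the defect `Ph * Sig.A * G * F`, the feedback
`Ph * Sig.B * Q` and the input mismatch `Ph * Sig.B * S`; the input matrix
`Sigh.B = [Ph * Sig.B, Ph * Sig.A * G]` is made to compensate exactly these, by the input with
components `ν - Q Ph ξ - S w` and `F ξ`.

It remains that a continuous linear map commutes with each of the three integrals. For the Itô
integral it maps approximating simple processes to approximating simple processes. For the jump
integral, which is a `finsum`, one needs that a counting path has finitely many jumps in `(0, t]`,
and that the left limits of the integrand exist.
-/

/-! ### Progressive processes and càdlàg paths under maps -/

section

variable {Ω : Type*} {mΩ : MeasurableSpace Ω}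

theorem MeasureTheory.IsProgressive.measurable_comp {𝓕 : Filtration ℝ≥0 mΩ} {α β : Type*}
    [MeasurableSpace α] [MeasurableSpace β] {u : ℝ≥0 → Ω → α} (hu : IsProgressive 𝓕 u)
    {g : α → β} (hg : Measurable g) : IsProgressive 𝓕 fun t ω => g (u t ω) :=
  fun i => hg.comp (hu i)

theorem MeasureTheory.IsProgressive.prodMk {𝓕 : Filtration ℝ≥0 mΩ} {α β : Type*}
    [MeasurableSpace α] [MeasurableSpace β] {u : ℝ≥0 → Ω → α} {v : ℝ≥0 → Ω → β}
    (hu : IsProgressive 𝓕 u) (hv : IsProgressive 𝓕 v) :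
    IsProgressive 𝓕 fun t ω => (u t ω, v t ω) :=
  fun i => Measurable.prodMk (hu i) (hv i)

theorem IsCadlagPath.continuous_comp {E E' : Type*} [NormedAddCommGroup E]
    [NormedAddCommGroup E'] {x : ℝ≥0 → E} (hx : IsCadlagPath x) {g : E → E'} (hg : Continuous g) :
    IsCadlagPath fun t => g (x t) := fun t =>
  ⟨hg.continuousAt.comp_continuousWithinAt (hx t).1,
    let ⟨y, hy⟩ := (hx t).2
    ⟨g y, (hg.tendsto y).comp hy⟩⟩

theorem IsCadlagPath.leftLim_continuous_comp {E E' : Type*} [NormedAddCommGroup E]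
    [NormedAddCommGroup E'] {x : ℝ≥0 → E} (hx : IsCadlagPath x) {g : E → E'} (hg : Continuous g)
    (t : ℝ≥0) : Function.leftLim (fun s => g (x s)) t = g (Function.leftLim x t) := by
  rcases eq_or_neBot (𝓝[<] t) with h | h
  · rw [leftLim_eq_of_eq_bot _ h, leftLim_eq_of_eq_bot _ h]
  · exact leftLim_eq_of_tendsto ((hg.tendsto _).comp (tendsto_leftLim_of_tendsto (hx t).2))

end

/-! ### Linear images of jump integrals -/

/-- A nondecreasing counting path has finitely many jumps in a bounded interval: it is injective on
its jump times, and bounded by its final value. -/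
theorem Monotone.finite_jumps_Ioc {c : ℝ≥0 → ℕ} (hc : Monotone c) (t : ℝ≥0) :
    {s ∈ Set.Ioc 0 t | (c s : ℝ) - Function.leftLim (fun u => (c u : ℝ)) s ≠ 0}.Finite := by
  have hc' : Monotone fun u => (c u : ℝ) := fun a b hab => Nat.cast_le.2 (hc hab)
  have hlt : ∀ a s, (c s : ℝ) - Function.leftLim (fun u => (c u : ℝ)) s ≠ 0 → a < s →
      c a < c s := by
    intro a s hs has
    refine (hc has.le).lt_of_ne fun h => hs ?_
    have h1 := hc'.le_leftLim has
    have h2 := hc'.leftLim_le (le_refl s)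
    simp only [h] at h1
    linarith
  refine Set.Finite.of_finite_image
    ((Set.finite_Iic (c t)).subset (Set.image_subset_iff.2 fun s hs => hc hs.1.2)) ?_
  intro a ha b hb hab
  by_contra hne
  rcases lt_or_gt_of_ne hne with h | h
  · exact (hlt a b hb.2 h).ne hab
  · exact (hlt b a ha.2 h).ne hab.symm

theorem ContinuousLinearMap.map_jumpIntegral {E E' : Type*} [NormedAddCommGroup E]
    [NormedSpace ℝ E] [NormedAddCommGroup E'] [NormedSpace ℝ E'] (L : E →L[ℝ] E') {x : ℝ≥0 → E}
    (hx : IsCadlagPath x) {c : ℝ≥0 → ℕ} (hc : Monotone c) (t : ℝ≥0) :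
    L (jumpIntegral x c t) = jumpIntegral (fun s => L (x s)) c t := by
  unfold jumpIntegral
  have hfin : (Set.Ioc 0 t ∩ Function.support fun s =>
      ((c s : ℝ) - Function.leftLim (fun u => (c u : ℝ)) s) • Function.leftLim x s).Finite :=
    (hc.finite_jumps_Ioc t).subset fun s hs => ⟨hs.1, left_ne_zero_of_smul hs.2⟩
  have h := AddMonoidHom.map_finsum_mem' (L : E →+ E') hfin
  simp only [AddMonoidHom.coe_coe, map_smul] at h
  rw [h]
  simp only [hx.leftLim_continuous_comp L.continuous]

/-! ### Linear images of Itô integrals -/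

section

variable {Ω : Type*} {mΩ : MeasurableSpace Ω} {𝓕 : Filtration ℝ≥0 mΩ} {E E' : Type*}
  [NormedAddCommGroup E] [NormedSpace ℝ E] [MeasurableSpace E] [OpensMeasurableSpace E]
  [NormedAddCommGroup E'] [NormedSpace ℝ E'] [MeasurableSpace E'] [BorelSpace E']

/-- The image of a simple process under a continuous linear map, applied to its values. -/
def SimpleProcess.map (V : SimpleProcess 𝓕 E) (L : E →L[ℝ] E') : SimpleProcess 𝓕 E' where
  card := V.card
  time := V.time
  value j ω := L (V.value j ω)
  monotone_time := V.monotone_time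
  measurable_value j := L.continuous.measurable.comp (V.measurable_value j)
  bounded_value := by
    obtain ⟨c, hc⟩ := V.bounded_value
    exact ⟨‖L‖ * c, fun j ω =>
      (L.le_opNorm _).trans (mul_le_mul_of_nonneg_left (hc j ω) (norm_nonneg L))⟩

theorem SimpleProcess.eval_map (V : SimpleProcess 𝓕 E) (L : E →L[ℝ] E') (t : ℝ≥0) (ω : Ω) :
    (V.map L).eval t ω = L (V.eval t ω) := by
  simp only [SimpleProcess.eval, SimpleProcess.map, map_sum, Set.indicator_apply, apply_ite L,
    map_zero]

theorem SimpleProcess.integral_map (V : SimpleProcess 𝓕 E) (L : E →L[ℝ] E')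
    (W : ℝ≥0 → Ω → ℝ) (t : ℝ≥0) (ω : Ω) :
    (V.map L).integral W t ω = L (V.integral W t ω) := by
  simp only [SimpleProcess.integral, SimpleProcess.map, map_sum, map_smul]

theorem IsItoIntegral.continuousLinearMap_comp {μ : Measure Ω} {W : ℝ≥0 → Ω → ℝ}
    {X I : ℝ≥0 → Ω → E} (h : IsItoIntegral 𝓕 μ W X I) (L : E →L[ℝ] E') :
    IsItoIntegral 𝓕 μ W (fun t ω => L (X t ω)) (fun t ω => L (I t ω)) := by
  obtain ⟨hI, hcont, V, hV⟩ := h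
  refine ⟨fun t => L.continuous.measurable.comp (hI t),
    hcont.mono fun ω hω => L.continuous.comp hω, fun k => (V k).map L, fun T ε hε => ?_⟩
  -- A positive bound of the operator norm, by which `ε` can be divided even if `L = 0`.
  obtain ⟨K, hK0, hK⟩ : ∃ K : ℝ≥0, K ≠ 0 ∧ ∀ v, ‖L v‖ₑ ≤ K * ‖v‖ₑ := by
    refine ⟨‖L‖₊ + 1, by positivity, fun v => ?_⟩
    have h1 : ‖L v‖₊ ≤ (‖L‖₊ + 1) * ‖v‖₊ :=
      (L.le_opNNNorm v).trans (mul_le_mul_of_nonneg_right (by simp) zero_le)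
    simp only [enorm_eq_nnnorm]
    exact_mod_cast h1
  have hK0' : (K : ℝ≥0∞) ≠ 0 := by exact_mod_cast hK0
  have hKt : (K : ℝ≥0∞) ≠ ∞ := ENNReal.coe_ne_top
  constructor
  · have hdiv : 0 < ε / (K : ℝ≥0∞) ^ 2 :=
      ENNReal.div_pos hε.ne' (ENNReal.pow_ne_top hKt)
    refine tendsto_of_tendsto_of_tendsto_of_le_of_le tendsto_const_nhds (hV T _ hdiv).1
      (fun _ => zero_le) fun k => measure_mono fun ω hω => ?_
    refine ENNReal.div_le_of_le_mul' (le_trans hω ?_)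
    rw [← lintegral_const_mul' _ _ (ENNReal.pow_ne_top hKt)]
    refine lintegral_mono fun s => ?_
    rw [SimpleProcess.eval_map, ← map_sub, ← mul_pow]
    exact pow_le_pow_left' (hK _) 2
  · have hdiv : 0 < ε / (K : ℝ≥0∞) := ENNReal.div_pos hε.ne' hKt
    refine tendsto_of_tendsto_of_tendsto_of_le_of_le tendsto_const_nhds (hV T _ hdiv).2
      (fun _ => zero_le) fun k => measure_mono fun ω hω => ?_
    refine ENNReal.div_le_of_le_mul' (le_trans hω ?_)
    refine iSup₂_le fun t ht => ?_
    rw [SimpleProcess.integral_map, ← map_sub]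
    refine (hK _).trans (mul_le_mul_right ?_ _)
    exact le_iSup₂_of_le t ht le_rfl

end

/-! ### The intertwining identities -/

section

variable {n nh m l p q r : Type*} [Fintype n] [Fintype nh] [Fintype m] [Fintype l] [Fintype p]
  [DecidableEq n] [DecidableEq nh]

/-- If `P` intertwines `X` and `Xh`, then so does its left inverse `Ph`, provided that `Ph * X`
vanishes on the range of the complementary projection `G * F`. -/
theorem Matrix.mul_eq_mul_of_leftInverse_of_intertwine {X : Matrix n n ℝ} {Xh : Matrix nh nh ℝ}
    {P : Matrix n nh ℝ} {Ph : Matrix nh n ℝ} {G : Matrix n l ℝ} {F : Matrix l n ℝ}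
    (hX : X * P = P * Xh) (hI : 1 = P * Ph + G * F) (hIh : 1 = Ph * P)
    (hG : 0 = Ph * X * G * F) : Xh * Ph = Ph * X := by
  calc Xh * Ph = Ph * P * Xh * Ph := by rw [← hIh, Matrix.one_mul]
    _ = Ph * (X * P) * Ph := by rw [hX]; simp only [Matrix.mul_assoc]
    _ = Ph * X * (P * Ph + G * F) := by
        rw [Matrix.mul_add, ← Matrix.mul_assoc (Ph * X) G F, ← hG, add_zero]
        simp only [Matrix.mul_assoc]
    _ = Ph * X := by rw [← hI, Matrix.mul_one]

/-- The drift of the abstraction along `Ph x`, under the compensating input, is the image under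
`Ph` of the drift of the concrete system. -/
theorem JLSS.drift_compensatingInput (Sig : JLSS n m p q r) (Sigh : JLSS nh (m ⊕ l) p q r)
    {P : Matrix n nh ℝ} {Q : Matrix m nh ℝ} {S : Matrix m p ℝ} {Ph : Matrix nh n ℝ}
    {G : Matrix n l ℝ} {F : Matrix l n ℝ}
    (hA : Sig.A * P = P * Sigh.A - Sig.B * Q) (hD : Sig.D = P * Sigh.D - Sig.B * S)
    (hB : Sigh.B = Matrix.fromCols (Ph * Sig.B) (Ph * Sig.A * G))
    (hI : 1 = P * Ph + G * F) (hIh : 1 = Ph * P) (x : n → ℝ) (u : m → ℝ) (w : p → ℝ) :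
    Sigh.drift (Ph *ᵥ x) (Sum.elim (u - Q *ᵥ (Ph *ᵥ x) - S *ᵥ w) (F *ᵥ x)) w
      = Ph *ᵥ Sig.drift x u w := by
  have hAh : Sigh.A = Ph * Sig.A * P + Ph * Sig.B * Q := by
    rw [Matrix.mul_assoc, hA, Matrix.mul_sub, ← Matrix.mul_assoc, ← hIh, Matrix.one_mul,
      Matrix.mul_assoc, sub_add_cancel]
  have hDh : Sigh.D = Ph * Sig.D + Ph * Sig.B * S := by
    rw [hD, Matrix.mul_sub, ← Matrix.mul_assoc, ← hIh, Matrix.one_mul,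
      Matrix.mul_assoc, sub_add_cancel]
  have hx : Ph *ᵥ (Sig.A *ᵥ x)
      = Ph *ᵥ Sig.A *ᵥ P *ᵥ Ph *ᵥ x + Ph *ᵥ Sig.A *ᵥ G *ᵥ F *ᵥ x := by
    rw [← Matrix.mulVec_add, ← Matrix.mulVec_add, Matrix.mulVec_mulVec x P,
      Matrix.mulVec_mulVec x G, ← Matrix.add_mulVec, ← hI, Matrix.one_mulVec]
  simp only [JLSS.drift, hB, hAh, hDh, Matrix.fromCols_mulVec_sumElim, Matrix.add_mulVec,
    ← Matrix.mulVec_mulVec, Matrix.mulVec_add, Matrix.mulVec_sub, hx]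
  abel

end

/-! ### The simulating trajectory -/

theorem mainTheorem4
    {Ω : Type*} {mΩ : MeasurableSpace Ω} (μ : Measure Ω) [IsProbabilityMeasure μ]
    (𝓕 : Filtration ℝ≥0 mΩ)
    {n nh m l p q r : ℕ}
    (W : ℝ≥0 → Ω → ℝ) (rate : Fin r → ℝ≥0) (N : Fin r → ℝ≥0 → Ω → ℕ)
    (hnoise : IsDrivingNoise 𝓕 μ W rate N)
    (Sig : JLSS (Fin n) (Fin m) (Fin p) (Fin q) (Fin r))
    (Sigh : JLSS (Fin nh) (Fin m ⊕ Fin l) (Fin p) (Fin q) (Fin r))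
    (P : Matrix (Fin n) (Fin nh) ℝ) (Q : Matrix (Fin m) (Fin nh) ℝ)
    (S : Matrix (Fin m) (Fin p) ℝ)
    (hA : Sig.A * P = P * Sigh.A - Sig.B * Q)
    (hD : Sig.D = P * Sigh.D - Sig.B * S)
    (hC : Sig.C * P = Sigh.C)
    (hE : Sig.E * P = P * Sigh.E)
    (hR : ∀ i, Sig.R i * P = P * Sigh.R i)
    (Ph : Matrix (Fin nh) (Fin n) ℝ) (G : Matrix (Fin n) (Fin l) ℝ)
    (F : Matrix (Fin l) (Fin n) ℝ)
    (hB : Sigh.B = Matrix.fromCols (Ph * Sig.B) (Ph * Sig.A * G))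
    (hCh : Sig.C = Sigh.C * Ph)
    (hI : 1 = P * Ph + G * F)
    (hIh : 1 = Ph * P)
    (hEh : 0 = Ph * Sig.E * G * F)
    (hRh : ∀ i, 0 = Ph * Sig.R i * G * F)
    (ξ : ℝ≥0 → Ω → (Fin n → ℝ)) (ζ : ℝ≥0 → Ω → (Fin q → ℝ))
    (ν : ℝ≥0 → Ω → (Fin m → ℝ)) (w : ℝ≥0 → Ω → (Fin p → ℝ))
    (htraj : Sig.IsTrajectory 𝓕 μ W N ξ ζ ν w) :
    ∃ (ξh : ℝ≥0 → Ω → (Fin nh → ℝ)) (ζh : ℝ≥0 → Ω → (Fin q → ℝ))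
      (νh : ℝ≥0 → Ω → (Fin m ⊕ Fin l → ℝ)) (wh : ℝ≥0 → Ω → (Fin p → ℝ)),
      Sigh.IsTrajectory 𝓕 μ W N ξh ζh νh wh ∧
      (∀ t ω, ξh t ω = Ph *ᵥ ξ t ω) ∧
      wh = w ∧
      ∀ᵐ ω ∂μ, ∀ t, ζ t ω = ζh t ω := by
  -- Left multiplication by `Ph`, as a continuous linear map.
  let L : (Fin n → ℝ) →L[ℝ] (Fin nh → ℝ) := LinearMap.toContinuousLinearMap Ph.mulVecLin
  have hL : ∀ x, L x = Ph *ᵥ x := fun _ => rfl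
  have hcont : ∀ {a b : ℕ} (M : Matrix (Fin a) (Fin b) ℝ), Continuous fun x => M *ᵥ x :=
    fun M => continuous_const.matrix_mulVec continuous_id
  have hEPh := Matrix.mul_eq_mul_of_leftInverse_of_intertwine hE hI hIh hEh
  have hRPh := fun i => Matrix.mul_eq_mul_of_leftInverse_of_intertwine (hR i) hI hIh (hRh i)
  have hdrift := fun s ω =>
    Sig.drift_compensatingInput Sigh hA hD hB hI hIh (ξ s ω) (ν s ω) (w s ω)
  have hξ := htraj.state.measurable_comp L.continuous.measurable
  refine ⟨fun t ω => Ph *ᵥ ξ t ω, fun t ω => Sigh.C *ᵥ (Ph *ᵥ ξ t ω),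
    fun t ω => Sum.elim (ν t ω - Q *ᵥ (Ph *ᵥ ξ t ω) - S *ᵥ w t ω) (F *ᵥ ξ t ω), w, ?_,
    fun _ _ => rfl, rfl, ?_⟩
  · refine
      { input := ?_
        internal_input := htraj.internal_input
        state := hξ
        cadlag := htraj.cadlag.mono fun ω h => h.continuous_comp L.continuous
        drift_integrable := ?_
        equation := ?_
        output_measurable := fun t =>
          (hcont Sigh.C).measurable.comp ((hξ.adapted t).mono (𝓕.le t) le_rfl)
        output := Eventually.of_forall fun _ _ => rfl }
    · refine ((htraj.state.prodMk htraj.input).prodMk htraj.internal_input).measurable_comp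
        (g := fun y => Sum.elim (y.1.2 - Q *ᵥ (Ph *ᵥ y.1.1) - S *ᵥ y.2) (F *ᵥ y.1.1)) ?_
      refine measurable_pi_iff.2 fun j => ?_
      have h1 := (hcont Q).comp (hcont Ph)
      rcases j with j | j
      · exact ((continuous_apply j).comp
          (((continuous_snd.comp continuous_fst).sub
            (h1.comp (continuous_fst.comp continuous_fst))).sub
              ((hcont S).comp continuous_snd))).measurable
      · exact ((continuous_apply j).comp
          ((hcont F).comp (continuous_fst.comp continuous_fst))).measurable
    · filter_upwards [htraj.drift_integrable] with ω h t
      simp only [hdrift]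
      exact L.integrable_comp (h t)
    · obtain ⟨I, hI', heq⟩ := htraj.equation
      refine ⟨fun t ω => Ph *ᵥ I t ω, ?_, ?_⟩
      · simpa only [hL, Matrix.mulVec_mulVec, hEPh] using hI'.continuousLinearMap_comp L
      · filter_upwards [heq, htraj.drift_integrable, htraj.cadlag,
          ae_all_iff.2 fun i => (hnoise.poisson i).monotone] with ω h hint hcad hmono t
        have hjump : ∀ i, jumpIntegral (fun s => Sigh.R i *ᵥ (Ph *ᵥ ξ s ω)) (fun s => N i s ω) t
            = L (jumpIntegral (fun s => Sig.R i *ᵥ ξ s ω) (fun s => N i s ω) t) := fun i => by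
          rw [L.map_jumpIntegral (hcad.continuous_comp (hcont (Sig.R i))) (hmono i)]
          simp only [hL, Matrix.mulVec_mulVec, hRPh]
        simp only [hdrift, hjump]
        simp only [← hL]
        rw [L.integral_comp_comm (hint t), ← map_sum, ← map_add, ← map_add, ← map_add, ← h t]
  · filter_upwards [htraj.output] with ω h t
    rw [h t, hCh, Matrix.mulVec_mulVec]
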